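/- **Setting.** Let $n\ge 1$, $s\in(0,1/2)$ and $m\ge 2$. Let $\mathscr S_m$ be the set of real symmetric $m\times m$ matrices $\boldsymbol\sigma=(\sigma_{ij})$ with $\sigma_{ii}=0$ and $\sigma_{ij}>0$ for $i\ne j$, and put $\boldsymbol\sigma_{\max}=\max_{i\ne j}\sigma_{ij}$, $\boldsymbol\sigma_{\min}=\min_{i\neq j}\sigma_{ij}$. For measurable $A,B\subset\mathbb R^n$ let $$\mathcal I_{2s}(A,B)=\iint_{A\times B}\frac{dx\,dy}{|x-y|^{n+2s}}\in[0,\infty],$$ and for an open set $\Omega\subset\mathbb R^n$ and $\mathfrak E=(E_1,\dots,E_m)$ let $$\mathscr P^{\boldsymbol\sigma}_{2s}(\mathfrak E,\Omega)=\frac12\sum_{i,j=1}^m\sigma_{ij}\Big[\mathcal I_{2s}(E_i\cap\Omega,E_j\cap\Omega)+\mathcal I_{2s}(E_i\cap\Omega,E_j\cap\Omega^c)+\mathcal I_{2s}(E_i\cap\Omega^c,E_j\cap\Omega)\Big]$$ (with $0\cdot\infty=0$). Let $\mathscr A_m(\Omega)$ be the class of $\mathfrak E=(E_1,\dots,E_m)$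 with $E_j\subset\mathbb R^n$ Lebesgue measurable, $\sum_j\chi_{E_j}=1$ a.e. in $\mathbb R^n$ and $\mathscr P^{\boldsymbol\sigma}_{2s}(\mathfrak E,\Omega)<\infty$. We say that $\mathfrak E\in\mathscr A_m(\Omega)$ is *$\mathscr P^{\boldsymbol\sigma}_{2s}$-minimizing in $\Omega$* if $\mathscr P^{\boldsymbol\sigma}_{2s}(\mathfrak E,\Omega)\le\mathscr P^{\boldsymbol\sigma}_{2s}(\mathfrak F,\Omega)$ for every $\mathfrak F\in\mathscr A_m(\Omega)$ with $\overline{F_j\triangle E_j}\subset\Omega$ for each $j$. Let $D_r(x_0)$ denote the open ball in $\mathbb R^n$. For $\boldsymbol\sigma\in\mathscr S_m$, $\mathfrak p>0$ and $h\in\{1,\dots,m\}$, say that *non-infiltration holds for the chamber $h$ with constant $\mathfrak p$* if for every open set $\Omega\subset\mathbb R^n$, every $\mathscr P^{\boldsymbol\sigma}_{2s}$-minimizing $\mathfrak E^*=(E_1^*,\dots,E_m^*)$ in $\Omega$ and every closed ball $\overline D_r(x_0)\subset\Omega$ with $r>0$, $$|E^*_h\cap D_r(x_0)|\le\mathfrak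 p\,r^n\ \Longrightarrow\ |E^*_h\cap D_{r/2}(x_0)|=0.$$ **Proposition.** 1. (Nearly homogeneous case.) For every $q<1$ there is a constant $\mathfrak p_1=\mathfrak p_1(q,s,n)>0$, depending only on $q,s,n$, such that for every $m\ge2$ and every $\boldsymbol\sigma\in\mathscr S_m$ with $$\frac{(m-2)\,\boldsymbol\sigma_{\max}}{(m-1)\,\boldsymbol\sigma_{\min}}=q,$$ non-infiltration holds with constant $\mathfrak p_1$ for every chamber $h\in\{1,\dots,m\}$. 2. ($m=3$, strict triangle inequality.) Let $\boldsymbol\sigma\in\mathscr S_3$ satisfy $\sigma_{ij}<\sigma_{ik}+\sigma_{kj}$ whenever $\{i,j,k\}=\{1,2,3\}$. Then there is a constant $\mathfrak p_2=\mathfrak p_2(\boldsymbol\sigma,s,n)>0$ such that non-infiltration holds with constant $\mathfrak p_2$ for every chamber $h\in\{1,2,3\}$. 3. ($m=3$, strict inverse triangle inequality.) Let $\boldsymbol\sigma\in\mathscr S_3$. There is a constant $\mathfrak p_3=\mathfrak p_3(\boldsymbol\sigma,s,n)>0$ such that, whenever $\{i_0,j_0,k_0\}=\{1,2,3\}$ and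 $\sigma_{i_0j_0}>\sigma_{i_0k_0}+\sigma_{k_0j_0}$, non-infiltration holds with constant $\mathfrak p_3$ for the two chambers $h\in\{i_0,j_0\}$. -/

import Mathlib

open MeasureTheory

noncomputable section

namespace NonlocalPartition

/-- The class `𝒮_m` of coefficient matrices: symmetric, zero on the diagonal and positive off the
diagonal. No triangle inequality and no embeddability is required. -/
def IsCoeffMatrix {m : ℕ} (σ : Matrix (Fin m) (Fin m) ℝ) : Prop :=
  (∀ i, σ i i = 0) ∧ (∀ i j, σ i j = σ j i) ∧ (∀ i j, i ≠ j → 0 < σ i j)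

/-- The set of off-diagonal coefficients (finite, and nonempty as soon as `2 ≤ m`). -/
def offDiagCoeffs {m : ℕ} (σ : Matrix (Fin m) (Fin m) ℝ) : Set ℝ :=
  {t | ∃ i j, i ≠ j ∧ σ i j = t}

/-- `σ_max = max_{i ≠ j} σ_ij`. -/
def coeffMax {m : ℕ} (σ : Matrix (Fin m) (Fin m) ℝ) : ℝ := sSup (offDiagCoeffs σ)

/-- `σ_min = min_{i ≠ j} σ_ij`. -/
def coeffMin {m : ℕ} (σ : Matrix (Fin m) (Fin m) ℝ) : ℝ := sInf (offDiagCoeffs σ)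

/-- `q = (m - 2) σ_max / ((m - 1) σ_min)`. -/
def homogeneityRatio {m : ℕ} (σ : Matrix (Fin m) (Fin m) ℝ) : ℝ :=
  (((m : ℝ) - 2) * coeffMax σ) / (((m : ℝ) - 1) * coeffMin σ)

/-- The nonlocal interaction `I_{2s}(A, B) = ∬_{A × B} |x - y|^{-(n + 2s)} dx dy ∈ [0, ∞]`. -/
def interaction {n : ℕ} (s : ℝ) (A B : Set (EuclideanSpace ℝ (Fin n))) : ENNReal :=
  ∫⁻ x in A, ∫⁻ y in B, ENNReal.ofReal (1 / ‖x - y‖ ^ ((n : ℝ) + 2 * s))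

/-- The partition energy `P^σ_{2s}(E, Ω) ∈ [0, ∞]`; in `[0, ∞]` one has `0 * ∞ = 0`, so the diagonal
terms (`σ_ii = 0`) do not contribute. -/
def partitionEnergy {n m : ℕ} (s : ℝ) (σ : Matrix (Fin m) (Fin m) ℝ)
    (E : Fin m → Set (EuclideanSpace ℝ (Fin n))) (Ω : Set (EuclideanSpace ℝ (Fin n))) : ENNReal :=
  (1 / 2) * ∑ i, ∑ j, ENNReal.ofReal (σ i j) *
    (interaction s (E i ∩ Ω) (E j ∩ Ω) + interaction s (E i ∩ Ω) (E j ∩ Ωᶜ)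
      + interaction s (E i ∩ Ωᶜ) (E j ∩ Ω))

/-- The class `𝒜_m(Ω)`: families of Lebesgue measurable subsets of `ℝⁿ` with `∑ j, χ_{E j} = 1`
almost everywhere in `ℝⁿ` and with finite energy in `Ω`. -/
def IsAdmissible {n m : ℕ} (s : ℝ) (σ : Matrix (Fin m) (Fin m) ℝ)
    (Ω : Set (EuclideanSpace ℝ (Fin n))) (E : Fin m → Set (EuclideanSpace ℝ (Fin n))) : Prop :=
  (∀ j, NullMeasurableSet (E j) volume) ∧
  (∀ᵐ x ∂(volume : Measure (EuclideanSpace ℝ (Fin n))),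
    ∑ j, (E j).indicator (fun _ => (1 : ℝ)) x = 1) ∧
  partitionEnergy s σ E Ω < ⊤

/-- `E ∈ 𝒜_m(Ω)` is `P^σ_{2s}`-minimizing in `Ω`: its energy is at most that of every
`F ∈ 𝒜_m(Ω)` such that the closure of each `F j ∆ E j` is contained in `Ω`. -/
def IsMinimizing {n m : ℕ} (s : ℝ) (σ : Matrix (Fin m) (Fin m) ℝ)
    (Ω : Set (EuclideanSpace ℝ (Fin n))) (E : Fin m → Set (EuclideanSpace ℝ (Fin n))) : Prop :=
  IsAdmissible s σ Ω E ∧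
  ∀ F : Fin m → Set (EuclideanSpace ℝ (Fin n)), IsAdmissible s σ Ω F →
    (∀ j, closure (symmDiff (F j) (E j)) ⊆ Ω) →
    partitionEnergy s σ E Ω ≤ partitionEnergy s σ F Ω

/-- Non-infiltration for the chamber `h`, with volume fraction `p`: whenever `Ω ⊆ ℝⁿ` is open, `E`
is minimizing in `Ω` and a closed ball of radius `r > 0` is contained in `Ω`, if the chamber
`E h` has volume at most `p rⁿ` in the ball, then it is negligible in the ball of half radius. -/
def NonInfiltration (n : ℕ) {m : ℕ} (s : ℝ) (σ : Matrix (Fin m) (Fin m) ℝ) (p : ℝ)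
    (h : Fin m) : Prop :=
  ∀ (Ω : Set (EuclideanSpace ℝ (Fin n))), IsOpen Ω →
  ∀ (E : Fin m → Set (EuclideanSpace ℝ (Fin n))), IsMinimizing s σ Ω E →
  ∀ (x₀ : EuclideanSpace ℝ (Fin n)) (r : ℝ), 0 < r → Metric.closedBall x₀ r ⊆ Ω →
    volume (E h ∩ Metric.ball x₀ r) ≤ ENNReal.ofReal (p * r ^ n) →
    volume (E h ∩ Metric.ball x₀ (r / 2)) = 0

end NonlocalPartition

end

/-! Let A be the part of the chamber h in a ball of radius ρ, and let X i be the interaction of A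
with the part of chamber i outside A. Handing A over to chamber j changes only the interactions of A
with its complement, so minimality gives ∑ σ h i * X i ≤ ∑ σ j i * X i for every j
(`IsMinimizing.sum_le_sum`). Each hypothesis on σ turns these linear inequalities into ∑ X i ≤ C * X
h (`ControlsInteractions`): the interaction of A with its whole complement is controlled by that
with the rest of its own chamber. For nearly homogeneous σ one averages over j; for three chambers
one combines the two available inequalities.

Put V(ρ) = |A|. The fractional isoperimetric inequality bounds the total interaction below by a
multiple of V(ρ)^(1 - 2s/n). The rest of the chamber lies outside the ball, so X h is at most a
multiple of the integral over A of the distance to the sphere to the power -2s. That weight is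
integrable in ρ because 2s < 1, and integrating over (ρ₁, ρ₂) yields V(ρ₁)^(1 - 2s/n) ≤ K (ρ₂ -
ρ₁)^(-2s) V(ρ₂) (`exists_ballVolume_decay`). The exponent on the left is below 1, so a De Giorgi
iteration forces V(r/2) = 0 once V(r) ≤ p rⁿ. Here p depends on σ only through C. -/

noncomputable section

namespace NonlocalPartition

open Set ENNReal

variable {n m : ℕ}

local notation "𝔼" n => EuclideanSpace ℝ (Fin n)

/-! ### The energy as an integral over pairs of points -/

/-- The singular kernel `|x - y|^{-(n + 2s)}` on pairs of points. -/
def kernel (n : ℕ) (s : ℝ) (z : (𝔼 n) × (𝔼 n)) : ENNReal :=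
  ENNReal.ofReal (1 / ‖z.1 - z.2‖ ^ ((n : ℝ) + 2 * s))

theorem measurable_kernel (n : ℕ) (s : ℝ) : Measurable (kernel n s) := by
  unfold kernel
  fun_prop

/-- The measure on pairs of points whose density is the singular kernel. -/
def pairMeasure (n : ℕ) (s : ℝ) : Measure ((𝔼 n) × (𝔼 n)) :=
  ((volume : Measure (𝔼 n)).prod volume).withDensity (kernel n s)

theorem interaction_eq_pairMeasure (s : ℝ) {A B : Set (𝔼 n)} (hA : MeasurableSet A)
    (hB : MeasurableSet B) : interaction s A B = pairMeasure n s (A ×ˢ B) := by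
  rw [pairMeasure, withDensity_apply _ (hA.prod hB), setLIntegral_prod]
  · rfl
  · exact (measurable_kernel n s).aemeasurable

theorem interaction_congr (s : ℝ) {A A' B B' : Set (𝔼 n)} (hA : A =ᵐ[volume] A')
    (hB : B =ᵐ[volume] B') : interaction s A B = interaction s A' B' := by
  unfold interaction
  rw [setLIntegral_congr hA]
  exact lintegral_congr fun x => setLIntegral_congr hB

/-- The kernel is symmetric; this merges the two mixed interactions of a set with its complement
into one term with factor 2. -/
theorem measurePreserving_swap_pairMeasure (n : ℕ) (s : ℝ) :
    MeasurePreserving Prod.swap (pairMeasure n s) (pairMeasure n s) := by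
  refine ⟨measurable_swap, ?_⟩
  ext S hS
  rw [Measure.map_apply measurable_swap hS, pairMeasure,
    withDensity_apply _ (measurable_swap hS), withDensity_apply _ hS,
    ← (Measure.measurePreserving_swap (μ := (volume : Measure (𝔼 n)))
      (ν := (volume : Measure (𝔼 n)))).setLIntegral_comp_preimage hS (measurable_kernel n s)]
  refine lintegral_congr fun z => ?_
  simp only [kernel, Prod.fst_swap, Prod.snd_swap, norm_sub_rev]

/-- The pairs of points of which at least one lies in `Ω`. -/
def touchingPairs (Ω : Set (𝔼 n)) : Set ((𝔼 n) × (𝔼 n)) := (Ωᶜ ×ˢ Ωᶜ)ᶜ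

theorem measurableSet_touchingPairs {Ω : Set (𝔼 n)} (hΩ : MeasurableSet Ω) :
    MeasurableSet (touchingPairs Ω) := (hΩ.compl.prod hΩ.compl).compl

theorem lintegral_label {α ι : Type*} [MeasurableSpace α] [Fintype ι] [MeasurableSpace ι]
    [MeasurableSingletonClass ι] (μ : Measure α) {v : α → ι} (hv : Measurable v)
    (w : ι → ENNReal) : ∫⁻ z, w (v z) ∂μ = ∑ i, w i * μ (v ⁻¹' {i}) := by
  rw [← lintegral_map (f := w) (measurable_of_finite w) hv, lintegral_fintype]
  refine Finset.sum_congr rfl fun i _ => ?_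
  rw [Measure.map_apply hv (measurableSet_singleton i)]

/-- The energy of a partition given by a measurable labelling. -/
theorem partitionEnergy_eq_lintegral (s : ℝ) (σ : Matrix (Fin m) (Fin m) ℝ)
    {E : Fin m → Set (𝔼 n)} {Ω : Set (𝔼 n)} (hΩ : MeasurableSet Ω) {u : (𝔼 n) → Fin m}
    (hu : Measurable u) (hE : ∀ j, E j =ᵐ[volume] u ⁻¹' {j}) :
    partitionEnergy s σ E Ω = (1 / 2) *
      ∫⁻ z in touchingPairs Ω, ENNReal.ofReal (σ (u z.1) (u z.2)) ∂pairMeasure n s := by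
  have hm : ∀ i, MeasurableSet (u ⁻¹' {i}) := fun i => hu (measurableSet_singleton i)
  have hv : Measurable (fun z : (𝔼 n) × (𝔼 n) => (u z.1, u z.2)) := by fun_prop
  rw [partitionEnergy, lintegral_label ((pairMeasure n s).restrict (touchingPairs Ω)) hv
    (fun p => ENNReal.ofReal (σ p.1 p.2)), Fintype.sum_prod_type]
  congr 1
  refine Finset.sum_congr rfl fun i _ => Finset.sum_congr rfl fun j _ => ?_
  congr 1
  have hi : ∀ (i : Fin m) (T : Set (𝔼 n)), (E i ∩ T : Set (𝔼 n)) =ᵐ[volume] (u ⁻¹' {i} ∩ T : Set _) :=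
    fun i T => (hE i).inter (ae_eq_refl T)
  rw [interaction_congr s (hi i Ω) (hi j Ω), interaction_congr s (hi i Ω) (hi j Ωᶜ),
    interaction_congr s (hi i Ωᶜ) (hi j Ω),
    interaction_eq_pairMeasure s ((hm i).inter hΩ) ((hm j).inter hΩ),
    interaction_eq_pairMeasure s ((hm i).inter hΩ) ((hm j).inter hΩ.compl),
    interaction_eq_pairMeasure s ((hm i).inter hΩ.compl) ((hm j).inter hΩ),
    -- The three boxes in the energy are disjoint, and together they are the pairs with labels (i,
    -- j) that touch Ω.
    Measure.restrict_apply (hv (measurableSet_singleton _)),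
    ← measure_union _ (((hm i).inter hΩ).prod ((hm j).inter hΩ.compl)),
    ← measure_union _ (((hm i).inter hΩ.compl).prod ((hm j).inter hΩ))]
  · congr 1
    ext ⟨x, y⟩
    simp only [touchingPairs, mem_union, mem_prod, mem_inter_iff, mem_preimage, mem_singleton_iff,
      mem_compl_iff, Prod.mk.injEq]
    tauto
  · rw [Set.disjoint_left]
    rintro ⟨x, y⟩
    simp only [mem_union, mem_prod, mem_inter_iff, mem_preimage, mem_singleton_iff, mem_compl_iff]
    tauto
  · rw [Set.disjoint_left]
    rintro ⟨x, y⟩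
    simp only [mem_prod, mem_inter_iff, mem_preimage, mem_singleton_iff, mem_compl_iff]
    tauto

/-- Splitting off the interactions of a set on which the label is constant. -/
theorem lintegral_touchingPairs_split (s : ℝ) {σ : Matrix (Fin m) (Fin m) ℝ}
    (hσ : IsCoeffMatrix σ) {A Ω : Set (𝔼 n)} (hΩ : MeasurableSet Ω) (hA : MeasurableSet A)
    (hAΩ : A ⊆ Ω) {u : (𝔼 n) → Fin m} (hu : Measurable u) {c : Fin m} (hc : ∀ x ∈ A, u x = c) :
    ∫⁻ z in touchingPairs Ω, ENNReal.ofReal (σ (u z.1) (u z.2)) ∂pairMeasure n s =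
      2 * ∑ i, ENNReal.ofReal (σ c i) * pairMeasure n s (A ×ˢ (Aᶜ ∩ u ⁻¹' {i})) +
      ∫⁻ z in touchingPairs Ω ∩ Aᶜ ×ˢ Aᶜ, ENNReal.ofReal (σ (u z.1) (u z.2)) ∂pairMeasure n s := by
  obtain ⟨h0, hsymm, -⟩ := hσ
  set κ := pairMeasure n s
  set f : (𝔼 n) × (𝔼 n) → ENNReal := fun z => ENNReal.ofReal (σ (u z.1) (u z.2)) with hf
  have hfm : Measurable f := by
    have h1 : Measurable (fun p : Fin m × Fin m => ENNReal.ofReal (σ p.1 p.2)) :=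
      measurable_of_finite _
    have hv : Measurable (fun z : (𝔼 n) × (𝔼 n) => (u z.1, u z.2)) := by fun_prop
    exact h1.comp hv
  -- Since A ⊆ Ω, every pair meeting A touches Ω, so only the pairs avoiding A remain truncated.
  have hset : touchingPairs Ω =
      ((A ×ˢ A ∪ A ×ˢ Aᶜ) ∪ Aᶜ ×ˢ A) ∪ (touchingPairs Ω ∩ Aᶜ ×ˢ Aᶜ) := by
    ext ⟨x, y⟩
    have hx := @hAΩ x
    have hy := @hAΩ y
    simp only [touchingPairs, mem_union, mem_prod, mem_inter_iff, mem_compl_iff]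
    tauto
  have hdiag : ∫⁻ z in A ×ˢ A, f z ∂κ = 0 := by
    rw [setLIntegral_congr_fun (g := fun _ => 0) (hA.prod hA)]
    · simp
    · rintro ⟨x, y⟩ ⟨hx, hy⟩
      simp [hf, hc x hx, hc y hy, h0]
  have hcross : ∫⁻ z in A ×ˢ Aᶜ, f z ∂κ =
      ∑ i, ENNReal.ofReal (σ c i) * κ (A ×ˢ (Aᶜ ∩ u ⁻¹' {i})) := by
    have hv : Measurable (fun z : (𝔼 n) × (𝔼 n) => u z.2) := by fun_prop
    rw [setLIntegral_congr_fun (g := fun z => ENNReal.ofReal (σ c (u z.2))) (hA.prod hA.compl),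
      lintegral_label (κ.restrict (A ×ˢ Aᶜ)) hv (fun i => ENNReal.ofReal (σ c i))]
    · refine Finset.sum_congr rfl fun i _ => ?_
      rw [Measure.restrict_apply (hv (measurableSet_singleton i))]
      congr 2
      ext ⟨x, y⟩
      simp only [mem_prod, mem_inter_iff, mem_preimage, mem_singleton_iff, mem_compl_iff]
      tauto
    · rintro ⟨x, y⟩ ⟨hx, hy⟩
      simp [hf, hc x hx]
  have hswap : ∫⁻ z in Aᶜ ×ˢ A, f z ∂κ = ∫⁻ z in A ×ˢ Aᶜ, f z ∂κ := by
    rw [← (measurePreserving_swap_pairMeasure n s).setLIntegral_comp_preimage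
      (hA.compl.prod hA) hfm, preimage_swap_prod]
    refine lintegral_congr fun z => ?_
    simp only [hf, Prod.fst_swap, Prod.snd_swap, hsymm (u z.2)]
  conv_lhs => rw [hset]
  rw [lintegral_union, lintegral_union, lintegral_union, hdiag, hswap, hcross]
  · ring
  · exact hA.prod hA.compl
  · rw [Set.disjoint_left]
    rintro ⟨x, y⟩
    simp only [mem_prod, mem_compl_iff]
    tauto
  · exact hA.compl.prod hA
  · rw [Set.disjoint_left]
    rintro ⟨x, y⟩
    simp only [mem_union, mem_prod, mem_compl_iff]
    tauto
  · exact (measurableSet_touchingPairs hΩ).inter (hA.compl.prod hA.compl)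
  · rw [Set.disjoint_left]
    rintro ⟨x, y⟩
    simp only [mem_union, mem_inter_iff, mem_prod, mem_compl_iff]
    tauto

/-! ### Labellings and competitors -/

/-- Up to null sets an admissible family is the family of level sets of a measurable labelling. -/
theorem IsAdmissible.exists_label {s : ℝ} {σ : Matrix (Fin m) (Fin m) ℝ} {Ω : Set (𝔼 n)}
    {E : Fin m → Set (𝔼 n)} (hE : IsAdmissible s σ Ω E) (h : Fin m) :
    ∃ u : (𝔼 n) → Fin m, Measurable u ∧ ∀ j, E j =ᵐ[volume] u ⁻¹' {j} := by
  classical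
  obtain ⟨hmeas, hsum, -⟩ := hE
  have huniq : ∀ᵐ x ∂(volume : Measure (𝔼 n)), ∃ i, ∀ j, x ∈ E j ↔ i = j := by
    filter_upwards [hsum] with x hx
    have hcard : (Finset.univ.filter fun j => x ∈ E j).card = 1 := by
      have : ((Finset.univ.filter fun j => x ∈ E j).card : ℝ) = 1 := by
        rw [← hx, Finset.card_filter]
        push_cast
        exact Finset.sum_congr rfl fun j _ => by simp [indicator_apply]
      exact_mod_cast this
    obtain ⟨i, hi⟩ := Finset.card_eq_one.mp hcard
    refine ⟨i, fun j => ?_⟩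
    have := Finset.ext_iff.mp hi j
    simpa [eq_comm] using this
  -- The value `h` off the good set is arbitrary: that set has full measure.
  let v : (𝔼 n) → Fin m := fun x => if hx : ∃ i, ∀ j, x ∈ E j ↔ i = j then hx.choose else h
  have hv : ∀ j, E j =ᵐ[volume] v ⁻¹' {j} := by
    intro j
    filter_upwards [huniq] with x hx
    have hvx : v x = hx.choose := dif_pos hx
    refine propext ?_
    change x ∈ E j ↔ v x = j
    rw [hvx]
    exact hx.choose_spec j
  have hvm : AEMeasurable v volume := by
    have : NullMeasurable v volume := by
      intro S _
      have : v ⁻¹' S = ⋃ j ∈ S, v ⁻¹' {j} := by ext; simp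
      rw [this]
      exact .biUnion (to_countable S) fun j _ => (hmeas j).congr (hv j)
    exact this.aemeasurable
  refine ⟨hvm.mk v, hvm.measurable_mk, fun j => (hv j).trans ?_⟩
  filter_upwards [hvm.ae_eq_mk] with x hx
  refine propext ?_
  change v x = j ↔ hvm.mk v x = j
  rw [hx]

/-- Transferring a piece of the chamber `h` to the chamber `j` does not decrease the energy of a
minimizer. -/
theorem IsMinimizing.sum_le_sum {s : ℝ} {σ : Matrix (Fin m) (Fin m) ℝ} (hσ : IsCoeffMatrix σ)
    {Ω : Set (𝔼 n)} (hΩ : IsOpen Ω) {E : Fin m → Set (𝔼 n)} (hE : IsMinimizing s σ Ω E)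
    {u : (𝔼 n) → Fin m} (hu : Measurable u) (huE : ∀ j, E j =ᵐ[volume] u ⁻¹' {j})
    {h : Fin m} {A : Set (𝔼 n)} (hA : MeasurableSet A) (hAh : A ⊆ u ⁻¹' {h})
    (hAΩ : closure A ⊆ Ω) :
    (∑ i, ENNReal.ofReal (σ h i) * pairMeasure n s (A ×ˢ (Aᶜ ∩ u ⁻¹' {i})) ≠ ⊤) ∧ ∀ j,
    ∑ i, ENNReal.ofReal (σ h i) * pairMeasure n s (A ×ˢ (Aᶜ ∩ u ⁻¹' {i})) ≤
      ∑ i, ENNReal.ofReal (σ j i) * pairMeasure n s (A ×ˢ (Aᶜ ∩ u ⁻¹' {i})) := by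
  classical
  have hAΩ' : A ⊆ Ω := subset_closure.trans hAΩ
  obtain ⟨hadm, hmin⟩ := hE
  have hPE := partitionEnergy_eq_lintegral s σ hΩ.measurableSet hu huE
  rw [lintegral_touchingPairs_split s hσ hΩ.measurableSet hA hAΩ' hu hAh, mul_add, ← mul_assoc,
    ENNReal.div_mul_cancel two_ne_zero ofNat_ne_top, one_mul] at hPE
  have hfin := hadm.2.2
  rw [hPE, ENNReal.add_lt_top] at hfin
  refine ⟨hfin.1.ne, fun j => ?_⟩
  let u' : (𝔼 n) → Fin m := A.piecewise (fun _ => j) u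
  have hu' : Measurable u' := Measurable.piecewise hA measurable_const hu
  -- The competitor modifies the sets `E i` themselves, not the level sets of `u`: the closure of `F
  -- i ∆ E i` must lie in Ω, and a null discrepancy could have a large closure.
  let F : Fin m → Set (𝔼 n) := fun i => (E i \ A) ∪ (if i = j then A else ∅)
  have hFu' : ∀ i, F i =ᵐ[volume] u' ⁻¹' {i} := by
    intro i
    filter_upwards [huE i] with x hx
    have hx' : x ∈ E i ↔ u x = i := iff_of_eq hx
    refine propext ?_
    change x ∈ (E i \ A) ∪ (if i = j then A else ∅) ↔ A.piecewise (fun _ => j) u x = i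
    by_cases hxA : x ∈ A
    · by_cases hij : i = j
      · simp [hxA, hij]
      · simp [hxA, hij, Ne.symm hij]
    · rw [piecewise_eq_of_notMem _ _ _ hxA, ← hx']
      by_cases hij : i = j <;> simp [hxA, hij]
  have hPF := partitionEnergy_eq_lintegral s σ hΩ.measurableSet hu' hFu'
  rw [lintegral_touchingPairs_split s hσ hΩ.measurableSet hA hAΩ' hu' (c := j)
    (fun x hx => piecewise_eq_of_mem _ _ _ hx), mul_add, ← mul_assoc,
    ENNReal.div_mul_cancel two_ne_zero ofNat_ne_top, one_mul] at hPF
  have hsum : ∑ i, ENNReal.ofReal (σ j i) * pairMeasure n s (A ×ˢ (Aᶜ ∩ u' ⁻¹' {i})) =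
      ∑ i, ENNReal.ofReal (σ j i) * pairMeasure n s (A ×ˢ (Aᶜ ∩ u ⁻¹' {i})) := by
    refine Finset.sum_congr rfl fun i _ => ?_
    congr 3
    ext x
    simp only [mem_inter_iff, mem_compl_iff, mem_preimage, mem_singleton_iff, u']
    refine and_congr_right fun hx => ?_
    rw [piecewise_eq_of_notMem _ _ _ hx]
  have hrest : ∫⁻ z in touchingPairs Ω ∩ Aᶜ ×ˢ Aᶜ, ENNReal.ofReal (σ (u' z.1) (u' z.2))
      ∂pairMeasure n s = ∫⁻ z in touchingPairs Ω ∩ Aᶜ ×ˢ Aᶜ, ENNReal.ofReal (σ (u z.1) (u z.2))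
      ∂pairMeasure n s := by
    refine setLIntegral_congr_fun ((measurableSet_touchingPairs hΩ.measurableSet).inter
      (hA.compl.prod hA.compl)) ?_
    rintro ⟨x, y⟩ ⟨-, hx, hy⟩
    simp only [u', piecewise_eq_of_notMem _ _ _ hx, piecewise_eq_of_notMem _ _ _ hy]
  rw [hsum, hrest] at hPF
  -- An infinite right-hand side is harmless; a finite one makes the competitor admissible.
  by_cases htop : ∑ i, ENNReal.ofReal (σ j i) * pairMeasure n s (A ×ˢ (Aᶜ ∩ u ⁻¹' {i})) = ⊤
  · rw [htop]
    exact le_top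
  have hF : IsAdmissible s σ Ω F := by
    refine ⟨fun i => ?_, ?_, ?_⟩
    · exact (hu' (measurableSet_singleton i)).nullMeasurableSet.congr (hFu' i).symm
    · have hall : ∀ᵐ x ∂(volume : Measure (𝔼 n)), ∀ i, x ∈ F i ↔ u' x = i :=
        ae_all_iff.mpr fun i => (hFu' i).mono fun x hx => iff_of_eq hx
      filter_upwards [hall] with x hx
      simp [indicator_apply, hx]
    · rw [hPF, ENNReal.add_lt_top]
      exact ⟨lt_top_iff_ne_top.mpr htop, hfin.2⟩
  have hle := hmin F hF fun i => (closure_mono fun x hx => ?_).trans hAΩ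
  · rw [hPE, hPF] at hle
    exact (ENNReal.add_le_add_iff_right hfin.2.ne).mp hle
  · by_contra hxA
    by_cases hij : i = j <;> simp [mem_symmDiff, F, hxA, hij] at hx

/-! ### Algebra of the coefficients -/

/-- The algebraic condition on the coefficients under which the interactions `X i` of a piece of the
chamber `h` with the chambers `i` are controlled by that with the rest of the chamber `h`. -/
def ControlsInteractions (σ : Matrix (Fin m) (Fin m) ℝ) (h : Fin m) (C : ℝ) : Prop :=
  ∀ X : Fin m → ℝ, (∀ i, 0 ≤ X i) → (∀ j, ∑ i, σ h i * X i ≤ ∑ i, σ j i * X i) →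
    ∑ i, X i ≤ C * X h

theorem ControlsInteractions.mono {σ : Matrix (Fin m) (Fin m) ℝ} {h : Fin m} {C C' : ℝ}
    (hC : ControlsInteractions σ h C) (hCC' : C ≤ C') : ControlsInteractions σ h C' :=
  fun X hX hle => (hC X hX hle).trans (mul_le_mul_of_nonneg_right hCC' (hX h))

theorem finite_offDiagCoeffs (σ : Matrix (Fin m) (Fin m) ℝ) : (offDiagCoeffs σ).Finite :=
  (finite_range fun p : Fin m × Fin m => σ p.1 p.2).subset <| by
    rintro t ⟨i, j, -, rfl⟩
    exact ⟨(i, j), rfl⟩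

theorem le_coeffMax (σ : Matrix (Fin m) (Fin m) ℝ) {i j : Fin m} (hij : i ≠ j) :
    σ i j ≤ coeffMax σ :=
  le_csSup (finite_offDiagCoeffs σ).bddAbove ⟨i, j, hij, rfl⟩

theorem coeffMin_le (σ : Matrix (Fin m) (Fin m) ℝ) {i j : Fin m} (hij : i ≠ j) :
    coeffMin σ ≤ σ i j :=
  csInf_le (finite_offDiagCoeffs σ).bddBelow ⟨i, j, hij, rfl⟩

theorem nonempty_offDiagCoeffs (hm : 2 ≤ m) (σ : Matrix (Fin m) (Fin m) ℝ) :
    (offDiagCoeffs σ).Nonempty :=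
  ⟨_, ⟨0, by omega⟩, ⟨1, by omega⟩, by simp, rfl⟩

theorem IsCoeffMatrix.coeffMin_pos (hm : 2 ≤ m) {σ : Matrix (Fin m) (Fin m) ℝ}
    (hσ : IsCoeffMatrix σ) : 0 < coeffMin σ := by
  obtain ⟨i, j, hij, h⟩ := (nonempty_offDiagCoeffs hm σ).csInf_mem (finite_offDiagCoeffs σ)
  rw [coeffMin, ← h]
  exact hσ.2.2 i j hij

/-- For m = 2 symmetry leaves a single coefficient; for m ≥ 3 use m - 1 ≤ 2(m - 2). This bound keeps
the final constant independent of m. -/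
theorem IsCoeffMatrix.coeffMax_le_two_mul (hm : 2 ≤ m) {σ : Matrix (Fin m) (Fin m) ℝ}
    (hσ : IsCoeffMatrix σ) (hq : homogeneityRatio σ < 1) : coeffMax σ ≤ 2 * coeffMin σ := by
  have hpos := hσ.coeffMin_pos hm
  obtain ⟨i, j, hij, h⟩ := (nonempty_offDiagCoeffs hm σ).csSup_mem (finite_offDiagCoeffs σ)
  obtain ⟨k, l, hkl, h'⟩ := (nonempty_offDiagCoeffs hm σ).csInf_mem (finite_offDiagCoeffs σ)
  change σ i j = coeffMax σ at h
  change σ k l = coeffMin σ at h'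
  rcases hm.eq_or_lt with rfl | hm
  · have : σ i j = σ k l := by
      have := hσ.2.1 0 1
      fin_cases i <;> fin_cases j <;> fin_cases k <;> fin_cases l <;> simp_all
    linarith
  · have hm' : (3 : ℝ) ≤ m := by exact_mod_cast hm
    have hmax : 0 < coeffMax σ := h ▸ hσ.2.2 i j hij
    rw [homogeneityRatio, div_lt_one (by nlinarith)] at hq
    nlinarith

/-- The nearly homogeneous case. -/
theorem IsCoeffMatrix.controlsInteractions_of_homogeneityRatio_lt (hm : 2 ≤ m)
    {σ : Matrix (Fin m) (Fin m) ℝ} (hσ : IsCoeffMatrix σ) (hq : homogeneityRatio σ < 1)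
    (h : Fin m) : ControlsInteractions σ h (1 + 2 / (1 - homogeneityRatio σ)) := by
  intro X hX hle
  have hpos := hσ.coeffMin_pos hm
  have hmax := hσ.coeffMax_le_two_mul hm hq
  have hm' : (2 : ℝ) ≤ m := by exact_mod_cast hm
  have hMm : coeffMin σ ≤ coeffMax σ := by
    obtain ⟨t, i, j, hij, -⟩ := nonempty_offDiagCoeffs hm σ
    exact (coeffMin_le σ hij).trans (le_coeffMax σ hij)
  set M := coeffMax σ
  set μ := coeffMin σ
  set q := homogeneityRatio σ with hqdef
  have hqeq : ((m : ℝ) - 2) * M = q * ((m - 1) * μ) := by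
    rw [hqdef, homogeneityRatio, div_mul_cancel₀]
    exact (mul_pos (by linarith) hpos).ne'
  set T := ∑ i ∈ Finset.univ.erase h, X i with hT
  have hT0 : 0 ≤ T := Finset.sum_nonneg fun i _ => hX i
  have hsplit : ∀ Y : Fin m → ℝ, ∑ i, Y i = Y h + ∑ i ∈ Finset.univ.erase h, Y i := fun Y =>
    (Finset.add_sum_erase _ _ (Finset.mem_univ h)).symm
  have hcard : ((Finset.univ.erase h).card : ℝ) = m - 1 := by
    rw [Finset.card_erase_of_mem (Finset.mem_univ h), Finset.card_fin, Nat.cast_sub (by omega)]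
    simp
  have hlow : μ * T ≤ ∑ i, σ h i * X i := by
    rw [hsplit, hσ.1, zero_mul, zero_add, hT, Finset.mul_sum]
    exact Finset.sum_le_sum fun i hi =>
      mul_le_mul_of_nonneg_right (coeffMin_le σ (Finset.ne_of_mem_erase hi).symm) (hX i)
  have hup : ∀ i, ∑ j ∈ Finset.univ.erase h, σ j i * X i ≤
      if i = h then ((m : ℝ) - 1) * M * X h else (m - 2) * M * X i := by
    intro i
    rw [← Finset.sum_mul]
    split_ifs with hi
    · subst hi
      refine mul_le_mul_of_nonneg_right ?_ (hX i)
      rw [← hcard, ← nsmul_eq_mul]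
      exact Finset.sum_le_card_nsmul _ _ _ fun j hj => le_coeffMax σ (Finset.ne_of_mem_erase hj)
    · refine mul_le_mul_of_nonneg_right ?_ (hX i)
      have hmem : i ∈ Finset.univ.erase h := Finset.mem_erase.mpr ⟨hi, Finset.mem_univ i⟩
      have hcard' : (((Finset.univ.erase h).erase i).card : ℝ) = m - 2 := by
        rw [Finset.card_erase_of_mem hmem, Nat.cast_sub (Finset.card_pos.mpr ⟨i, hmem⟩), hcard]
        push_cast
        ring
      rw [← Finset.add_sum_erase _ _ hmem, hσ.1, zero_add, ← hcard', ← nsmul_eq_mul]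
      exact Finset.sum_le_card_nsmul _ _ _ fun j hj => le_coeffMax σ (Finset.ne_of_mem_erase hj)
  -- Sum the inequalities over the m - 1 chambers j ≠ h. For i ≠ h, the diagonal zero leaves only m
  -- - 2 coefficients in front of X i, which is where the ratio q comes from.
  have havg : ((m : ℝ) - 1) * ∑ i, σ h i * X i ≤ (m - 1) * M * X h + (m - 2) * M * T := by
    calc ((m : ℝ) - 1) * ∑ i, σ h i * X i
        = ∑ j ∈ Finset.univ.erase h, ∑ i, σ h i * X i := by
          rw [Finset.sum_const, nsmul_eq_mul, hcard]
      _ ≤ ∑ j ∈ Finset.univ.erase h, ∑ i, σ j i * X i := Finset.sum_le_sum fun j _ => hle j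
      _ = ∑ i, ∑ j ∈ Finset.univ.erase h, σ j i * X i := Finset.sum_comm
      _ ≤ ∑ i, if i = h then ((m : ℝ) - 1) * M * X h else (m - 2) * M * X i :=
          Finset.sum_le_sum fun i _ => hup i
      _ = (m - 1) * M * X h + (m - 2) * M * T := by
          rw [hsplit, if_pos rfl, hT, Finset.mul_sum]
          congr 1
          exact Finset.sum_congr rfl fun i hi => if_neg (Finset.ne_of_mem_erase hi)
  -- Dividing by (m - 1)μ gives T ≤ q T + 2 X h.
  have hfinal : (1 - q) * T ≤ 2 * X h := by
    have h1 : 0 < ((m : ℝ) - 1) * μ := mul_pos (by linarith) hpos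
    have h2 : ((m : ℝ) - 1) * (μ * T) ≤ (m - 1) * M * X h + (m - 2) * M * T :=
      (mul_le_mul_of_nonneg_left hlow (by linarith)).trans havg
    have h3 : ((m : ℝ) - 1) * M * X h ≤ (m - 1) * (2 * μ) * X h :=
      mul_le_mul_of_nonneg_right (mul_le_mul_of_nonneg_left hmax (by linarith)) (hX h)
    rw [hqeq] at h2
    refine le_of_mul_le_mul_left ?_ h1
    linarith
  have hq1 : 0 < 1 - q := by linarith
  rw [hsplit, add_mul, one_mul, div_mul_eq_mul_div]
  refine add_le_add le_rfl ?_
  rw [le_div_iff₀ hq1]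
  linarith

/-- The case of three chambers, two of which satisfy the strict triangle inequality through the
third. -/
theorem IsCoeffMatrix.exists_controlsInteractions_of_lt_add {σ : Matrix (Fin 3) (Fin 3) ℝ}
    (hσ : IsCoeffMatrix σ) {h i j : Fin 3} (hhi : h ≠ i) (hhj : h ≠ j) (hij : i ≠ j)
    (hlt : σ i j < σ i h + σ h j) : ∃ C : ℝ, ControlsInteractions σ h C := by
  obtain ⟨h0, hsymm, hpos⟩ := hσ
  have hsum : ∀ Y : Fin 3 → ℝ, ∑ k, Y k = Y h + Y i + Y j := by
    intro Y
    rw [Fin.sum_univ_three]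
    fin_cases h <;> fin_cases i <;> fin_cases j <;> simp at * <;> ring
  have ha := hpos h i hhi
  have hb := hpos h j hhj
  rw [hsymm i h] at hlt
  set a := σ h i
  set b := σ h j
  set d := a + b - σ i j with hd
  have hd0 : 0 < d := by linarith
  set e := min a b
  have he : 0 < e := lt_min ha hb
  refine ⟨1 + 2 * a * b / (d * e), fun X hX hle => ?_⟩
  have h1 := hle i
  have h2 := hle j
  rw [hsum, hsum, h0, h0, hsymm i h] at h1
  rw [hsum, hsum, h0, h0, hsymm j h, hsymm j i] at h2
  have hc : σ i j = a + b - d := by rw [hd]; ring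
  change 0 * X h + a * X i + b * X j ≤ a * X h + 0 * X i + σ i j * X j at h1
  change 0 * X h + a * X i + b * X j ≤ b * X h + σ i j * X i + 0 * X j at h2
  rw [hc] at h1 h2
  -- Adding b times the first inequality to a times the second leaves the strictness gap d as the
  -- coefficient of a X i + b X j.
  have h3 : d * (a * X i + b * X j) ≤ 2 * a * b * X h := by
    have h1' := mul_le_mul_of_nonneg_left h1 hb.le
    have h2' := mul_le_mul_of_nonneg_left h2 ha.le
    nlinarith
  have h4 : e * (X i + X j) ≤ a * X i + b * X j := by
    rw [mul_add]
    exact add_le_add (mul_le_mul_of_nonneg_right (min_le_left _ _) (hX i))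
      (mul_le_mul_of_nonneg_right (min_le_right _ _) (hX j))
  have h5 : d * e * (X i + X j) ≤ 2 * a * b * X h := by
    rw [mul_assoc]
    exact (mul_le_mul_of_nonneg_left h4 hd0.le).trans h3
  rw [hsum, add_mul, one_mul, div_mul_eq_mul_div, add_assoc]
  refine add_le_add le_rfl ?_
  rw [le_div_iff₀ (mul_pos hd0 he)]
  linarith

/-- One constant must serve all chambers before it is known which triangle inequalities hold. There
are finitely many chambers, so an upper bound of their individual constants works. -/
theorem IsCoeffMatrix.exists_controlsInteractions_forall {σ : Matrix (Fin 3) (Fin 3) ℝ}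
    (hσ : IsCoeffMatrix σ) : ∃ C : ℝ, ∀ h i j : Fin 3, h ≠ i → h ≠ j → i ≠ j →
      σ i j < σ i h + σ h j → ControlsInteractions σ h C := by
  classical
  have key : ∀ h : Fin 3, ∃ C : ℝ, ∀ i j : Fin 3, h ≠ i → h ≠ j → i ≠ j →
      σ i j < σ i h + σ h j → ControlsInteractions σ h C := by
    intro h
    by_cases hex : ∃ C : ℝ, ControlsInteractions σ h C
    · obtain ⟨C, hC⟩ := hex
      exact ⟨C, fun _ _ _ _ _ _ => hC⟩
    -- If no constant works for h, the strict inequality cannot hold, so any value will do.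
    · exact ⟨0, fun i j hhi hhj hij hlt =>
        absurd (hσ.exists_controlsInteractions_of_lt_add hhi hhj hij hlt) hex⟩
  choose C hC using key
  obtain ⟨B, hB⟩ := (finite_range C).bddAbove
  exact ⟨B, fun h i j hhi hhj hij hlt =>
    (hC h i j hhi hhj hij hlt).mono (hB (mem_range_self h))⟩

/-! ### From the algebraic condition to the interactions of a minimizer -/

/-- Control of the total interaction of a piece of a chamber of a minimizer by the interaction with
the rest of that chamber. -/
theorem IsMinimizing.pairMeasure_compl_le {s : ℝ} {σ : Matrix (Fin m) (Fin m) ℝ}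
    (hσ : IsCoeffMatrix σ) {h : Fin m} {C : ℝ} (hC0 : 0 < C) (hC : ControlsInteractions σ h C)
    {Ω : Set (𝔼 n)} (hΩ : IsOpen Ω)
    {E : Fin m → Set (𝔼 n)} (hE : IsMinimizing s σ Ω E)
    {u : (𝔼 n) → Fin m} (hu : Measurable u)
    (huE : ∀ j, E j =ᵐ[volume] u ⁻¹' {j}) {A : Set (𝔼 n)}
    (hA : MeasurableSet A) (hAh : A ⊆ u ⁻¹' {h}) (hAΩ : closure A ⊆ Ω) :
    pairMeasure n s (A ×ˢ Aᶜ) ≤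
      ENNReal.ofReal C * pairMeasure n s (A ×ˢ (Aᶜ ∩ u ⁻¹' {h})) := by
  obtain ⟨hfin, hle⟩ := hE.sum_le_sum hσ hΩ hu huE hA hAh hAΩ
  set X : Fin m → ENNReal := fun i => pairMeasure n s (A ×ˢ (Aᶜ ∩ u ⁻¹' {i})) with hX
  have htotal : pairMeasure n s (A ×ˢ Aᶜ) = ∑ i, X i := by
    have hv : Measurable (fun z : (𝔼 n) × (𝔼 n) => u z.2) :=
      by fun_prop
    have := lintegral_label ((pairMeasure n s).restrict (A ×ˢ Aᶜ)) hv fun _ => 1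
    simp only [lintegral_one, Measure.restrict_apply_univ, one_mul] at this
    rw [this]
    refine Finset.sum_congr rfl fun i _ => ?_
    rw [Measure.restrict_apply (hv (measurableSet_singleton i)), hX]
    congr 1
    ext ⟨x, y⟩
    simp only [mem_prod, mem_inter_iff, mem_preimage, mem_singleton_iff, mem_compl_iff]
    tauto
  rw [htotal]
  change ∑ i, X i ≤ ENNReal.ofReal C * X h
  change ∑ i, ENNReal.ofReal (σ h i) * X i ≠ ⊤ at hfin
  change ∀ j, ∑ i, ENNReal.ofReal (σ h i) * X i ≤ ∑ i, ENNReal.ofReal (σ j i) * X i at hle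
  by_cases hXh : X h = ⊤
  · rw [hXh, ENNReal.mul_top (ENNReal.ofReal_pos.mpr hC0).ne']
    exact le_top
  -- Finiteness of the weighted sum passes to each X i with i ≠ h because σ h i > 0; the diagonal
  -- coefficient says nothing about X h, hence the separate case above.
  have hXfin : ∀ i, X i ≠ ⊤ := by
    intro i
    by_cases hi : i = h
    · rwa [hi]
    · intro htop
      have := ENNReal.sum_ne_top.mp hfin i (Finset.mem_univ i)
      rw [htop, ENNReal.mul_top (ENNReal.ofReal_pos.mpr (hσ.2.2 h i (Ne.symm hi))).ne'] at this
      exact this rfl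
  lift X to Fin m → NNReal using hXfin with Y
  have hσ0 : ∀ i j, 0 ≤ σ i j := by
    intro i j
    rcases eq_or_ne i j with rfl | hij
    · exact (hσ.1 i).ge
    · exact (hσ.2.2 i j hij).le
  have hconv : ∀ j, ∑ i, ENNReal.ofReal (σ j i) * (Y i : ENNReal) =
      ENNReal.ofReal (∑ i, σ j i * (Y i : ℝ)) := by
    intro j
    rw [ENNReal.ofReal_sum_of_nonneg (f := fun i => σ j i * (Y i : ℝ))
      fun i _ => mul_nonneg (hσ0 j i) (Y i).2]
    refine Finset.sum_congr rfl fun i _ => ?_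
    rw [ENNReal.ofReal_mul (hσ0 j i), ENNReal.ofReal_coe_nnreal]
  have hreal := hC (fun i => (Y i : ℝ)) (fun i => (Y i).2) fun j => by
    have := hle j
    rw [hconv, hconv] at this
    exact (ENNReal.ofReal_le_ofReal_iff
      (Finset.sum_nonneg fun i _ => mul_nonneg (hσ0 j i) (Y i).2)).mp this
  have := ENNReal.ofReal_le_ofReal hreal
  rw [ENNReal.ofReal_sum_of_nonneg (f := fun i => (Y i : ℝ)) fun i _ => (Y i).2,
    ENNReal.ofReal_mul hC0.le] at this
  simpa only [ENNReal.ofReal_coe_nnreal] using this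

theorem pairMeasure_prod (s : ℝ) {A B : Set (𝔼 n)} (hA : MeasurableSet A)
    (hB : MeasurableSet B) :
    pairMeasure n s (A ×ˢ B) = ∫⁻ x in A, ∫⁻ y in B, kernel n s (x, y) :=
  (interaction_eq_pairMeasure s hA hB).symm

/-! ### Isoperimetric inequality and kernel tails -/

/-- The fractional isoperimetric inequality. -/
theorem exists_isoperimetric (hn : 1 ≤ n) {s : ℝ} (hs : 0 < s) (hs' : s < 1 / 2) :
    ∃ c : ℝ, 0 < c ∧ ∀ A : Set (𝔼 n), MeasurableSet A → volume A ≠ ⊤ →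
      ENNReal.ofReal (c * (volume A).toReal ^ (1 - 2 * s / n)) ≤ pairMeasure n s (A ×ˢ Aᶜ) := by
  have hn' : (1 : ℝ) ≤ n := by exact_mod_cast hn
  have hn0 : (0 : ℝ) < n := by linarith
  set a : ℝ := 2 * s / n with ha
  have ha1 : a < 1 := by rw [ha, div_lt_one hn0]; linarith
  have ha0 : 0 < a := by positivity
  set ω : ℝ := (volume (Metric.ball (0 : (𝔼 n)) 1)).toReal with hω
  have hω0 : 0 < ω := ENNReal.toReal_pos (Metric.measure_ball_pos _ _ one_pos).ne'
    measure_ball_lt_top.ne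
  refine ⟨(2 / ω) ^ (-(1 + a)), by positivity, fun A hA hfin => ?_⟩
  set V := (volume A).toReal with hV
  have hVof : volume A = ENNReal.ofReal V := (ENNReal.ofReal_toReal hfin).symm
  have hVnn : 0 ≤ V := ENNReal.toReal_nonneg
  rcases hVnn.eq_or_lt with hV0 | hV0
  · rw [← hV0, Real.zero_rpow (by linarith), mul_zero, ENNReal.ofReal_zero]
    exact zero_le
  -- A ball of radius R has volume 2V, so around any x in A at least volume V of it lies outside A,
  -- where the kernel is at least R^(-(n + 2s)).
  set R : ℝ := (2 * V / ω) ^ (1 / (n : ℝ)) with hR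
  have hR0 : 0 < R := by positivity
  have hRn : R ^ n * ω = 2 * V := by
    rw [hR, ← Real.rpow_natCast, ← Real.rpow_mul (by positivity), one_div_mul_cancel hn0.ne',
      Real.rpow_one, div_mul_cancel₀ _ hω0.ne']
  have hball : ∀ x : (𝔼 n),
      volume (Metric.ball x R) = ENNReal.ofReal (2 * V) := by
    intro x
    rw [Measure.addHaar_ball_of_pos _ _ hR0, finrank_euclideanSpace_fin, ← hRn,
      ENNReal.ofReal_mul (by positivity), hω, ENNReal.ofReal_toReal measure_ball_lt_top.ne]
  have hinner : ∀ x ∈ A, ENNReal.ofReal (1 / R ^ ((n : ℝ) + 2 * s)) * ENNReal.ofReal V ≤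
      ∫⁻ y in Aᶜ, kernel n s (x, y) := by
    intro x hx
    calc ENNReal.ofReal (1 / R ^ ((n : ℝ) + 2 * s)) * ENNReal.ofReal V
        ≤ ENNReal.ofReal (1 / R ^ ((n : ℝ) + 2 * s)) * volume (Metric.ball x R \ A) := by
          gcongr
          refine le_trans (le_of_eq ?_) le_measure_sdiff
          rw [hball, hVof, ← ENNReal.ofReal_sub _ hV0.le]
          congr 1
          ring
      _ = ∫⁻ _ in Metric.ball x R \ A, ENNReal.ofReal (1 / R ^ ((n : ℝ) + 2 * s)) :=
          (setLIntegral_const _ _).symm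
      _ ≤ ∫⁻ y in Metric.ball x R \ A, kernel n s (x, y) := by
          refine setLIntegral_mono' (Metric.isOpen_ball.measurableSet.diff hA) fun y hy => ?_
          have hxy : 0 < ‖x - y‖ := norm_sub_pos_iff.mpr fun h => hy.2 (h ▸ hx)
          have hyR : ‖x - y‖ ≤ R := by
            have := hy.1
            rw [Metric.mem_ball, dist_comm, dist_eq_norm] at this
            exact this.le
          unfold kernel
          gcongr
      _ ≤ ∫⁻ y in Aᶜ, kernel n s (x, y) :=
          lintegral_mono_set fun y hy => hy.2
  have hRp : 1 / R ^ ((n : ℝ) + 2 * s) * V * V = (2 / ω) ^ (-(1 + a)) * V ^ (1 - a) := by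
    have h1 : 1 / (n : ℝ) * (n + 2 * s) = 1 + a := by
      rw [ha]
      field_simp
    have h2 : 2 * V / ω = (2 / ω) * V := by ring
    have h3 : V ^ (1 - a) = V ^ (-(1 + a)) * V * V := by
      rw [show 1 - a = -(1 + a) + 1 + 1 by ring, Real.rpow_add_one hV0.ne',
        Real.rpow_add_one hV0.ne']
    rw [hR, ← Real.rpow_mul (by positivity), h1, one_div, ← Real.rpow_neg (by positivity), h2,
      Real.mul_rpow (by positivity) hV0.le, h3]
    ring
  rw [pairMeasure_prod s hA hA.compl, ← hRp, ENNReal.ofReal_mul (by positivity),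
    ENNReal.ofReal_mul (by positivity), ← hVof, ← setLIntegral_const]
  refine setLIntegral_mono' hA fun x hx => ?_
  rw [hVof]
  exact hinner x hx

/-- The decay of the tails of the kernel. -/
theorem exists_tail_le (hn : 1 ≤ n) {s : ℝ} (hs : 0 < s) :
    ∃ C : ℝ, 0 < C ∧ ∀ (x : (𝔼 n)) (d : ℝ), 0 < d →
      ∫⁻ y in (Metric.ball x d)ᶜ, kernel n s (x, y) ≤ ENNReal.ofReal (C * d ^ (-(2 * s))) := by
  set p : ℝ := n + 2 * s with hp
  have hp0 : 0 < p := by positivity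
  have hJfin : ∫⁻ z : (𝔼 n), ENNReal.ofReal ((1 + ‖z‖) ^ (-p)) < ⊤ :=
    finite_integral_one_add_norm (by rw [finrank_euclideanSpace_fin]; linarith)
  set J := ∫⁻ z : (𝔼 n), ENNReal.ofReal ((1 + ‖z‖) ^ (-p)) with hJ
  refine ⟨2 ^ p * (J.toReal + 1), by positivity, fun x d hd => ?_⟩
  -- For ‖z‖ ≥ d one has d + ‖z‖ ≤ 2‖z‖, so g dominates the kernel; it is integrable on the whole
  -- space because p > n.
  let g : (𝔼 n) → ENNReal := fun z =>
    ENNReal.ofReal ((2 / d) ^ p) * ENNReal.ofReal ((1 + ‖d⁻¹ • z‖) ^ (-p))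
  have hle : ∀ y ∈ (Metric.ball x d)ᶜ, kernel n s (x, y) ≤ g (x - y) := by
    intro y hy
    have hyd : d ≤ ‖x - y‖ := by
      rwa [mem_compl_iff, Metric.mem_ball, not_lt, dist_comm, dist_eq_norm] at hy
    have hxy : 0 < ‖x - y‖ := hd.trans_le hyd
    simp only [kernel, g]
    rw [← ENNReal.ofReal_mul (by positivity)]
    refine ENNReal.ofReal_le_ofReal ?_
    rw [norm_smul, norm_inv, Real.norm_of_nonneg hd.le, Real.rpow_neg (by positivity),
      ← Real.inv_rpow (by positivity), ← Real.mul_rpow (by positivity) (by positivity), one_div,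
      ← Real.inv_rpow (by positivity)]
    refine Real.rpow_le_rpow (by positivity) ?_ hp0.le
    rw [inv_le_iff_one_le_mul₀ hxy]
    have : 2 / d * (1 + d⁻¹ * ‖x - y‖)⁻¹ * ‖x - y‖ = 2 * ‖x - y‖ / (d + ‖x - y‖) := by
      field_simp
    rw [this, one_le_div (by positivity)]
    linarith
  have hscale : ∫⁻ z : (𝔼 n), ENNReal.ofReal ((1 + ‖d⁻¹ • z‖) ^ (-p)) =
      ENNReal.ofReal (d ^ n) * J := by
    have hmeas : Measurable fun z : (𝔼 n) =>
      ENNReal.ofReal ((1 + ‖z‖) ^ (-p)) := by fun_prop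
    rw [← lintegral_map (f := fun z => ENNReal.ofReal ((1 + ‖z‖) ^ (-p))) hmeas
      (measurable_const_smul d⁻¹), Measure.map_addHaar_smul _ (inv_ne_zero hd.ne'),
      lintegral_smul_measure, finrank_euclideanSpace_fin, smul_eq_mul, inv_pow, inv_inv,
      abs_of_pos (pow_pos hd n)]
  calc ∫⁻ y in (Metric.ball x d)ᶜ, kernel n s (x, y)
      ≤ ∫⁻ y in (Metric.ball x d)ᶜ, g (x - y) :=
        setLIntegral_mono' Metric.isOpen_ball.measurableSet.compl hle
    _ ≤ ∫⁻ y, g (x - y) := setLIntegral_le_lintegral _ _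
    _ = ∫⁻ z, g z := lintegral_sub_left_eq_self g x
    _ = ENNReal.ofReal ((2 / d) ^ p) * (ENNReal.ofReal (d ^ n) * J) := by
        rw [lintegral_const_mul _ (by fun_prop), hscale]
    _ = ENNReal.ofReal ((2 / d) ^ p * (d ^ n * J.toReal)) := by
        rw [ENNReal.ofReal_mul (by positivity), ENNReal.ofReal_mul (by positivity),
          ENNReal.ofReal_toReal hJfin.ne]
    _ ≤ ENNReal.ofReal (2 ^ p * (J.toReal + 1) * d ^ (-(2 * s))) := by
        refine ENNReal.ofReal_le_ofReal ?_
        have h1 : d ^ n = d ^ p * d ^ (-(2 * s)) := by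
          rw [← Real.rpow_add hd, hp, ← Real.rpow_natCast]
          congr 1
          ring
        rw [h1, Real.div_rpow zero_le_two hd.le]
        have h2 : (2 : ℝ) ^ p / d ^ p * (d ^ p * d ^ (-(2 * s)) * J.toReal) =
            2 ^ p * J.toReal * d ^ (-(2 * s)) := by
          have : d ^ p ≠ 0 := by positivity
          field_simp
        rw [h2]
        gcongr
        linarith

/-! ### Integration in the radius and decay of volumes -/

/-- The singular weight `t^{-2s}` on positive reals. -/
def weight (s t : ℝ) : ENNReal := if 0 < t then ENNReal.ofReal (t ^ (-(2 * s))) else 0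

theorem measurable_weight (s : ℝ) : Measurable (weight s) :=
  Measurable.ite measurableSet_Ioi (by fun_prop) measurable_const

/-- The bound is uniform in the position τ of the singularity, since the worst case puts it at the
left endpoint; 2s < 1 makes it integrable there. -/
theorem setLIntegral_weight_le {s : ℝ} (hs : 0 < s) (hs' : s < 1 / 2) (τ : ℝ) {ρ₁ ρ₂ : ℝ}
    (hρ : ρ₁ < ρ₂) : ∫⁻ ρ in Ioo ρ₁ ρ₂, weight s (ρ - τ) ≤
      ENNReal.ofReal ((ρ₂ - ρ₁) ^ (1 - 2 * s) / (1 - 2 * s)) := by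
  set d := ρ₂ - ρ₁ with hd
  have hd0 : 0 < d := by linarith
  -- Moving the singularity right to b only increases the weight on the part of the interval where
  -- it is nonzero.
  set b := max τ ρ₁ with hb
  let g : ℝ → ENNReal := (Ioc 0 d).indicator fun t => ENNReal.ofReal (t ^ (-(2 * s)))
  have hle : ∀ ρ ∈ Ioo ρ₁ ρ₂, weight s (ρ - τ) ≤ g (ρ - b) := by
    intro ρ hρ'
    unfold weight
    split_ifs with hpos
    · have hbρ : b < ρ := max_lt (by linarith) hρ'.1
      have hmem : ρ - b ∈ Ioc 0 d :=
        ⟨by linarith, by linarith [hρ'.2, le_max_right τ ρ₁]⟩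
      simp only [g, indicator_of_mem hmem]
      refine ENNReal.ofReal_le_ofReal ?_
      exact Real.rpow_le_rpow_of_nonpos hmem.1 (by linarith [le_max_left τ ρ₁]) (by linarith)
    · exact zero_le
  have hint : IntervalIntegrable (fun t : ℝ => t ^ (-(2 * s))) volume 0 d :=
    intervalIntegral.intervalIntegrable_rpow' (by linarith)
  calc ∫⁻ ρ in Ioo ρ₁ ρ₂, weight s (ρ - τ)
      ≤ ∫⁻ ρ in Ioo ρ₁ ρ₂, g (ρ - b) := setLIntegral_mono' measurableSet_Ioo hle
    _ ≤ ∫⁻ ρ, g (ρ - b) := setLIntegral_le_lintegral _ _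
    _ = ∫⁻ t, g t := lintegral_sub_right_eq_self g b
    _ = ∫⁻ t in Ioc 0 d, ENNReal.ofReal (t ^ (-(2 * s))) := lintegral_indicator measurableSet_Ioc _
    _ = ENNReal.ofReal (∫ t in Ioc 0 d, t ^ (-(2 * s))) := by
        refine (ofReal_integral_eq_lintegral_ofReal
          ((intervalIntegrable_iff_integrableOn_Ioc_of_le hd0.le).mp hint) ?_).symm
        filter_upwards [ae_restrict_mem measurableSet_Ioc] with t ht
        exact Real.rpow_nonneg ht.1.le _
    _ = ENNReal.ofReal (d ^ (1 - 2 * s) / (1 - 2 * s)) := by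
        rw [← intervalIntegral.integral_of_le hd0.le, integral_rpow (Or.inl (by linarith)),
          Real.zero_rpow (by linarith), sub_zero, show -(2 * s) + 1 = 1 - 2 * s by ring]

/-- The volume of a set in the concentric balls around a point. -/
def ballVolume (S : Set (𝔼 n)) (x₀ : (𝔼 n)) (ρ : ℝ) : ℝ :=
  (volume (S ∩ Metric.ball x₀ ρ)).toReal

theorem volume_inter_ball_ne_top (S : Set (𝔼 n))
    (x₀ : (𝔼 n)) (ρ : ℝ) : volume (S ∩ Metric.ball x₀ ρ) ≠ ⊤ :=
  ((measure_mono inter_subset_right).trans_lt measure_ball_lt_top).ne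

theorem ballVolume_mono (S : Set (𝔼 n)) (x₀ : (𝔼 n)) :
    Monotone (ballVolume S x₀) := fun _ _ h =>
  ENNReal.toReal_mono (volume_inter_ball_ne_top _ _ _)
    (measure_mono (inter_subset_inter_right _ (Metric.ball_subset_ball h)))

theorem ballVolume_nonneg (S : Set (𝔼 n)) (x₀ : (𝔼 n))
    (ρ : ℝ) : 0 ≤ ballVolume S x₀ ρ := ENNReal.toReal_nonneg

/-- If the interaction of the part of `S` in the balls with its complement is controlled by the
interaction with the rest of `S`, then the volumes of these parts satisfy a decay estimate. -/
theorem exists_ballVolume_decay (hn : 1 ≤ n) {s : ℝ} (hs : 0 < s) (hs' : s < 1 / 2) {C : ℝ}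
    (hC : 0 < C) :
    ∃ K : ℝ, 0 < K ∧ ∀ S : Set (𝔼 n), MeasurableSet S →
      ∀ (x₀ : (𝔼 n)) (ρ₁ ρ₂ : ℝ), ρ₁ < ρ₂ →
        (∀ ρ ∈ Ioo ρ₁ ρ₂, pairMeasure n s ((S ∩ Metric.ball x₀ ρ) ×ˢ (S ∩ Metric.ball x₀ ρ)ᶜ) ≤
          ENNReal.ofReal C *
            pairMeasure n s ((S ∩ Metric.ball x₀ ρ) ×ˢ ((S ∩ Metric.ball x₀ ρ)ᶜ ∩ S))) →
        ballVolume S x₀ ρ₁ ^ (1 - 2 * s / n) ≤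
          K * (ρ₂ - ρ₁) ^ (-(2 * s)) * ballVolume S x₀ ρ₂ := by
  obtain ⟨c, hc, hiso⟩ := exists_isoperimetric hn hs hs'
  obtain ⟨D, hD, htail⟩ := exists_tail_le hn hs
  have hs1 : 0 < 1 - 2 * s := by linarith
  have hn' : (1 : ℝ) ≤ n := by exact_mod_cast hn
  have hexp : 0 ≤ 1 - 2 * s / n := by
    rw [sub_nonneg, div_le_one (by linarith)]
    linarith
  refine ⟨C * D / (c * (1 - 2 * s)), by positivity, fun S hS x₀ ρ₁ ρ₂ hρ hctrl => ?_⟩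
  set d := ρ₂ - ρ₁ with hd
  have hd0 : 0 < d := by linarith
  set B := S ∩ Metric.ball x₀ ρ₂ with hB
  have hBm : MeasurableSet B := hS.inter Metric.isOpen_ball.measurableSet
  have hpoint : ∀ ρ ∈ Ioo ρ₁ ρ₂, ENNReal.ofReal (c * ballVolume S x₀ ρ₁ ^ (1 - 2 * s / n)) ≤
      ENNReal.ofReal (C * D) * ∫⁻ x in B, weight s (ρ - dist x x₀) := by
    intro ρ hρ'
    set A := S ∩ Metric.ball x₀ ρ with hA
    have hAm : MeasurableSet A := hS.inter Metric.isOpen_ball.measurableSet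
    have hAB : A ⊆ B := inter_subset_inter_right _ (Metric.ball_subset_ball hρ'.2.le)
    calc ENNReal.ofReal (c * ballVolume S x₀ ρ₁ ^ (1 - 2 * s / n))
        ≤ ENNReal.ofReal (c * ballVolume S x₀ ρ ^ (1 - 2 * s / n)) := by
          refine ENNReal.ofReal_le_ofReal (mul_le_mul_of_nonneg_left ?_ hc.le)
          exact Real.rpow_le_rpow (ballVolume_nonneg _ _ _) (ballVolume_mono _ _ hρ'.1.le) hexp
      _ ≤ pairMeasure n s (A ×ˢ Aᶜ) := hiso A hAm (volume_inter_ball_ne_top _ _ _)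
      _ ≤ ENNReal.ofReal C * pairMeasure n s (A ×ˢ (Aᶜ ∩ S)) := hctrl ρ hρ'
      _ ≤ ENNReal.ofReal C * ∫⁻ x in A, ENNReal.ofReal D * weight s (ρ - dist x x₀) := by
          gcongr
          rw [pairMeasure_prod s hAm (hAm.compl.inter hS)]
          refine setLIntegral_mono' hAm fun x hx => ?_
          have hpos : 0 < ρ - dist x x₀ := sub_pos.mpr hx.2
          -- Points of S outside A lie outside the ball of radius ρ around x₀, hence at distance at
          -- least ρ - dist x x₀ from x.
          calc ∫⁻ y in Aᶜ ∩ S, kernel n s (x, y)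
              ≤ ∫⁻ y in (Metric.ball x (ρ - dist x x₀))ᶜ, kernel n s (x, y) := by
                refine lintegral_mono_set fun y hy hy' => hy.1 ⟨hy.2, ?_⟩
                rw [Metric.mem_ball] at hy' ⊢
                linarith [dist_triangle y x x₀]
            _ ≤ ENNReal.ofReal D * weight s (ρ - dist x x₀) := by
                rw [weight, if_pos hpos, ← ENNReal.ofReal_mul hD.le]
                exact htail x _ hpos
      -- Passing to B, which does not depend on ρ, prepares the exchange of integrals; the weight
      -- vanishes on the added points.
      _ ≤ ENNReal.ofReal C * ∫⁻ x in B, ENNReal.ofReal D * weight s (ρ - dist x x₀) := by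
          gcongr
      _ = ENNReal.ofReal (C * D) * ∫⁻ x in B, weight s (ρ - dist x x₀) := by
          have hwρ : Measurable fun x : (𝔼 n) => weight s (ρ - dist x x₀) :=
            (measurable_weight s).comp (by fun_prop)
          rw [lintegral_const_mul _ hwρ, ← mul_assoc,
            ENNReal.ofReal_mul hC.le]
  have hw : Measurable (fun p : ℝ × (𝔼 n) => weight s (p.1 - dist p.2 x₀)) :=
    (measurable_weight s).comp (by fun_prop)
  have hint : ENNReal.ofReal (c * ballVolume S x₀ ρ₁ ^ (1 - 2 * s / n) * d) ≤
      ENNReal.ofReal (C * D * (d ^ (1 - 2 * s) / (1 - 2 * s)) * ballVolume S x₀ ρ₂) := by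
    calc ENNReal.ofReal (c * ballVolume S x₀ ρ₁ ^ (1 - 2 * s / n) * d)
        = ∫⁻ _ in Ioo ρ₁ ρ₂, ENNReal.ofReal (c * ballVolume S x₀ ρ₁ ^ (1 - 2 * s / n)) := by
          rw [setLIntegral_const, Real.volume_Ioo, ENNReal.ofReal_mul
            (mul_nonneg hc.le (Real.rpow_nonneg (ballVolume_nonneg _ _ _) _))]
      _ ≤ ∫⁻ ρ in Ioo ρ₁ ρ₂, ENNReal.ofReal (C * D) * ∫⁻ x in B, weight s (ρ - dist x x₀) :=
          setLIntegral_mono' measurableSet_Ioo hpoint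
      _ = ENNReal.ofReal (C * D) *
            ∫⁻ ρ in Ioo ρ₁ ρ₂, ∫⁻ x in B, weight s (ρ - dist x x₀) :=
          lintegral_const_mul _ hw.lintegral_prod_right'
      _ = ENNReal.ofReal (C * D) *
            ∫⁻ x in B, ∫⁻ ρ in Ioo ρ₁ ρ₂, weight s (ρ - dist x x₀) := by
          rw [lintegral_lintegral_swap hw.aemeasurable]
      _ ≤ ENNReal.ofReal (C * D) *
            ∫⁻ _ in B, ENNReal.ofReal (d ^ (1 - 2 * s) / (1 - 2 * s)) := by
          gcongr with x
          exact setLIntegral_weight_le hs hs' _ hρ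
      _ = ENNReal.ofReal (C * D * (d ^ (1 - 2 * s) / (1 - 2 * s)) * ballVolume S x₀ ρ₂) := by
          rw [setLIntegral_const, mul_assoc (C * D), ENNReal.ofReal_mul (p := C * D) (by positivity),
            ENNReal.ofReal_mul (p := d ^ (1 - 2 * s) / (1 - 2 * s)) (by positivity), ballVolume,
            ENNReal.ofReal_toReal (volume_inter_ball_ne_top _ _ _)]
  have hreal := (ENNReal.ofReal_le_ofReal_iff
    (mul_nonneg (by positivity) (ballVolume_nonneg _ _ _))).mp hint
  have hpow : d ^ (1 - 2 * s) = d ^ (-(2 * s)) * d := by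
    rw [show 1 - 2 * s = -(2 * s) + 1 by ring, Real.rpow_add_one hd0.ne']
  rw [hpow] at hreal
  refine le_of_mul_le_mul_right ?_ (mul_pos hc hd0)
  calc ballVolume S x₀ ρ₁ ^ (1 - 2 * s / n) * (c * d)
      = c * ballVolume S x₀ ρ₁ ^ (1 - 2 * s / n) * d := by ring
    _ ≤ C * D * (d ^ (-(2 * s)) * d / (1 - 2 * s)) * ballVolume S x₀ ρ₂ := hreal
    _ = C * D / (c * (1 - 2 * s)) * d ^ (-(2 * s)) * ballVolume S x₀ ρ₂ * (c * d) := by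
        field_simp

/-! ### De Giorgi iteration -/

/-- The De Giorgi iteration. -/
theorem exists_vanishing_of_decay (hn : 1 ≤ n) {s : ℝ} (hs : 0 < s) (hs' : s < 1 / 2) {K : ℝ}
    (hK : 0 < K) : ∃ p : ℝ, 0 < p ∧ ∀ (V : ℝ → ℝ) (r : ℝ), 0 < r → Monotone V →
      (∀ ρ, 0 ≤ V ρ) → (∀ ρ₁ ρ₂, ρ₁ < ρ₂ → ρ₂ ≤ r →
        V ρ₁ ^ (1 - 2 * s / n) ≤ K * (ρ₂ - ρ₁) ^ (-(2 * s)) * V ρ₂) →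
      V r ≤ p * r ^ n → V (r / 2) = 0 := by
  have hn' : (1 : ℝ) ≤ n := by exact_mod_cast hn
  have hn0 : (0 : ℝ) < n := by linarith
  set a : ℝ := 2 * s / n with ha
  have ha0 : 0 < a := by positivity
  have ha1 : 0 < 1 - a := by
    rw [ha, sub_pos, div_lt_one hn0]
    linarith
  have hna : (n : ℝ) * (1 - a) = n - 2 * s := by
    rw [ha]
    field_simp
  -- Chosen so that `hpa` holds: the bound p lⁿ then reproduces itself exactly when l is halved and
  -- the radii differ by l/4.
  set p : ℝ := (K * 2 ^ ((n : ℝ) + 2 * s)) ^ (-(1 / a)) with hp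
  have hp0 : 0 < p := by positivity
  have hpa : K * 2 ^ ((n : ℝ) + 2 * s) * p ^ a = 1 := by
    rw [hp, ← Real.rpow_mul (by positivity), show -(1 / a) * a = -1 by field_simp,
      Real.rpow_neg_one, mul_inv_cancel₀ (by positivity)]
  have hstep : ∀ l : ℝ, 0 < l →
      K * (l / 4) ^ (-(2 * s)) * (p * l ^ n) = (p * (l / 2) ^ n) ^ (1 - a) := by
    intro l hl
    have h4 : (l / 4) ^ (-(2 * s)) = l ^ (-(2 * s)) * (2 ^ (2 * s) * 2 ^ (2 * s)) := by
      rw [Real.div_rpow hl.le (by norm_num), Real.rpow_neg (by norm_num : (0 : ℝ) ≤ 4),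
        div_inv_eq_mul, ← Real.mul_rpow zero_le_two zero_le_two]
      norm_num
    have h2 : ((l / 2) ^ n) ^ (1 - a) = l ^ (-(2 * s)) * l ^ n * (2 ^ (2 * s) / 2 ^ (n : ℝ)) := by
      rw [← Real.rpow_natCast, ← Real.rpow_mul (by positivity), hna,
        Real.div_rpow hl.le zero_le_two, ← Real.rpow_natCast l, ← Real.rpow_add hl,
        ← Real.rpow_sub two_pos, show -(2 * s) + (n : ℝ) = n - 2 * s by ring,
        show 2 * s - (n : ℝ) = -(n - 2 * s) by ring, Real.rpow_neg zero_le_two, div_eq_mul_inv]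
    have hp1 : p = p ^ (1 - a) * p ^ a := by
      rw [← Real.rpow_add hp0, sub_add_cancel, Real.rpow_one]
    rw [Real.mul_rpow hp0.le (by positivity), h4, h2]
    rw [Real.rpow_add two_pos] at hpa
    have h2n : (0 : ℝ) < 2 ^ (n : ℝ) := by positivity
    have : K * 2 ^ (2 * s) * p ^ a = 1 / 2 ^ (n : ℝ) := by
      rw [eq_div_iff h2n.ne', ← hpa]
      ring
    calc K * (l ^ (-(2 * s)) * (2 ^ (2 * s) * 2 ^ (2 * s))) * (p * l ^ n)
        = K * (l ^ (-(2 * s)) * (2 ^ (2 * s) * 2 ^ (2 * s))) * (p ^ (1 - a) * p ^ a * l ^ n) := by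
          rw [← hp1]
      _ = (K * 2 ^ (2 * s) * p ^ a) * (p ^ (1 - a) * (l ^ (-(2 * s)) * l ^ n * 2 ^ (2 * s))) := by
          ring
      _ = _ := by
          rw [this]
          ring
  refine ⟨p, hp0, fun V r hr hmono hV hdecay hstart => ?_⟩
  -- The radii r/2 + l/2 with l = r/2^k decrease from r to r/2, with consecutive gaps l/4.
  have hiter : ∀ k : ℕ, V (r / 2 + r / 2 ^ k / 2) ≤ p * (r / 2 ^ k) ^ n := by
    intro k
    induction k with
    | zero => simpa using hstart
    | succ k ih =>
      have hl : 0 < r / 2 ^ k := by positivity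
      have hl' : r / 2 ^ (k + 1) = r / 2 ^ k / 2 := by rw [pow_succ, div_div]
      have hlr : r / 2 ^ k ≤ r := div_le_self hr.le (one_le_pow₀ one_le_two)
      rw [hl']
      set l := r / 2 ^ k
      have := hdecay (r / 2 + l / 2 / 2) (r / 2 + l / 2) (by linarith) (by linarith)
      rw [show r / 2 + l / 2 - (r / 2 + l / 2 / 2) = l / 4 by ring] at this
      have h1 := this.trans (mul_le_mul_of_nonneg_left ih (by positivity))
      rw [hstep l hl] at h1
      exact (Real.rpow_le_rpow_iff (hV _) (by positivity) ha1).mp h1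
  have hlim : Filter.Tendsto (fun k : ℕ => p * (r / 2 ^ k) ^ n) Filter.atTop (nhds 0) := by
    have h1 : Filter.Tendsto (fun k : ℕ => r / 2 ^ k) Filter.atTop (nhds 0) :=
      tendsto_const_nhds.div_atTop (tendsto_pow_atTop_atTop_of_one_lt one_lt_two)
    have h2 := (h1.pow n).const_mul p
    rwa [zero_pow (by omega), mul_zero] at h2
  refine le_antisymm (ge_of_tendsto' hlim fun k => ?_) (hV _)
  have : 0 < r / 2 ^ k := by positivity
  exact (hmono (by linarith)).trans (hiter k)

/-! ### Conclusion -/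

/-- Non-infiltration with a constant that depends on the coefficients only through the constant of
the algebraic condition. -/
theorem exists_nonInfiltration (hn : 1 ≤ n) {s : ℝ} (hs : 0 < s) (hs' : s < 1 / 2) {C : ℝ}
    (hC : 0 < C) : ∃ p : ℝ, 0 < p ∧ ∀ (m : ℕ) (σ : Matrix (Fin m) (Fin m) ℝ), IsCoeffMatrix σ →
      ∀ h : Fin m, ControlsInteractions σ h C → NonInfiltration n s σ p h := by
  obtain ⟨K, hK, hdecay⟩ := exists_ballVolume_decay hn hs hs' hC
  obtain ⟨p, hp, hvanish⟩ := exists_vanishing_of_decay hn hs hs' hK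
  refine ⟨p, hp, fun m σ hσ h hctrl Ω hΩ E hE x₀ r hr hball hvol => ?_⟩
  obtain ⟨u, hu, huE⟩ := hE.1.exists_label h
  set S := u ⁻¹' {h} with hS
  have hSm : MeasurableSet S := hu (measurableSet_singleton h)
  have hES : ∀ ρ, volume (E h ∩ Metric.ball x₀ ρ) = volume (S ∩ Metric.ball x₀ ρ) := fun ρ =>
    measure_congr ((huE h).inter (ae_eq_refl _))
  have hV := hvanish (ballVolume S x₀) r hr (ballVolume_mono S x₀) (ballVolume_nonneg S x₀)
    (fun ρ₁ ρ₂ hρ hρr => hdecay S hSm x₀ ρ₁ ρ₂ hρ fun ρ hρ' => ?_) ?_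
  · rw [hES]
    exact ((ENNReal.toReal_eq_zero_iff _).mp hV).resolve_right (volume_inter_ball_ne_top _ _ _)
  · refine hE.pairMeasure_compl_le hσ hC hctrl hΩ hu huE
      (hSm.inter Metric.isOpen_ball.measurableSet) inter_subset_left ?_
    refine (closure_mono inter_subset_right).trans (Metric.closure_ball_subset_closedBall.trans ?_)
    exact (Metric.closedBall_subset_closedBall (hρ'.2.le.trans hρr)).trans hball
  · rw [hES] at hvol
    exact ENNReal.toReal_le_of_le_ofReal (by positivity) hvol

end NonlocalPartition

end

theorem mainTheorem9 (n : ℕ) (hn : 1 ≤ n) (s : ℝ) (hs : 0 < s) (hs' : s < 1 / 2) :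
    -- nearly homogeneous case: the constant depends only on `q`, `s`, `n`
    (∀ q : ℝ, q < 1 → ∃ p : ℝ, 0 < p ∧
      ∀ (m : ℕ), 2 ≤ m → ∀ σ : Matrix (Fin m) (Fin m) ℝ,
        NonlocalPartition.IsCoeffMatrix σ → NonlocalPartition.homogeneityRatio σ = q →
        ∀ h : Fin m, NonlocalPartition.NonInfiltration n s σ p h) ∧
    -- three chambers, strict triangle inequality: the constant depends only on `σ`, `s`, `n`
    (∀ σ : Matrix (Fin 3) (Fin 3) ℝ, NonlocalPartition.IsCoeffMatrix σ →
      (∀ i j k : Fin 3, i ≠ j → i ≠ k → k ≠ j → σ i j < σ i k + σ k j) →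
      ∃ p : ℝ, 0 < p ∧ ∀ h : Fin 3, NonlocalPartition.NonInfiltration n s σ p h) ∧
    -- three chambers, strict inverse triangle inequality: same dependence of the constant
    (∀ σ : Matrix (Fin 3) (Fin 3) ℝ, NonlocalPartition.IsCoeffMatrix σ →
      ∃ p : ℝ, 0 < p ∧
        ∀ i₀ j₀ k₀ : Fin 3, i₀ ≠ j₀ → k₀ ≠ i₀ → k₀ ≠ j₀ → σ i₀ j₀ > σ i₀ k₀ + σ k₀ j₀ →
          ∀ h : Fin 3, h = i₀ ∨ h = j₀ → NonlocalPartition.NonInfiltration n s σ p h) := by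
  refine ⟨fun q hq => ?_, fun σ hσ htri => ?_, fun σ hσ => ?_⟩
  · have hq1 : 0 < 1 - q := by linarith
    obtain ⟨p, hp, H⟩ := NonlocalPartition.exists_nonInfiltration hn hs hs'
      (C := 1 + 2 / (1 - q)) (by positivity)
    refine ⟨p, hp, fun m hm σ hσ hσq h => H m σ hσ h ?_⟩
    subst hσq
    exact hσ.controlsInteractions_of_homogeneityRatio_lt hm hq h
  · obtain ⟨C, hC⟩ := hσ.exists_controlsInteractions_forall
    obtain ⟨p, hp, H⟩ := NonlocalPartition.exists_nonInfiltration hn hs hs'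
      -- The algebraic constant carries no sign information; the maximum with 1 makes it positive.
      (C := max C 1) (lt_max_of_lt_right one_pos)
    refine ⟨p, hp, fun h => H 3 σ hσ h ?_⟩
    have hij : h + 1 ≠ h + 2 := by revert h; decide
    have hhi : h ≠ h + 1 := by revert h; decide
    have hhj : h ≠ h + 2 := by revert h; decide
    exact (hC h (h + 1) (h + 2) hhi hhj hij
      (htri _ _ _ hij hhi.symm hhj)).mono (le_max_left _ _)
  · obtain ⟨C, hC⟩ := hσ.exists_controlsInteractions_forall
    obtain ⟨p, hp, H⟩ := NonlocalPartition.exists_nonInfiltration hn hs hs'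
      (C := max C 1) (lt_max_of_lt_right one_pos)
    refine ⟨p, hp, fun i j k hij hki hkj hlt h hh => H 3 σ hσ h ?_⟩
    have hik := hσ.2.2 i k hki.symm
    have hkj' := hσ.2.2 k j hkj
    have hsymm := hσ.2.1
    -- Since σ i j is strictly the largest coefficient, the strict triangle inequalities through i
    -- and through j hold automatically; only the one through k fails.
    rcases hh with rfl | rfl
    · refine (hC h j k hij hki.symm hkj.symm ?_).mono (le_max_left _ _)
      linarith [hsymm j k, hsymm j h]
    · refine (hC h i k hij.symm hkj.symm hki.symm ?_).mono (le_max_left _ _)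
      linarith [hsymm h k]
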